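/- Let $\|\cdot\|_2$ be the norm of $L^2(\mathbb R)$ and $\widehat f(\omega)=\int_{\mathbb R}f(x)e^{-i\omega x}\,dx$ (extended to $L^2(\mathbb R)$ by Plancherel). For $a,b>0$ and $\epsilon_T,\epsilon_\Omega\ge 0$, a function $f\in L^2(\mathbb R)$ with $\|f\|_2=1$ is called $\epsilon_T$-concentrated in $T=[-a,a]$ and $\epsilon_\Omega$-band concentrated in $\Omega=[-b,b]$ if $$\int_{T^c}|f(t)|^2\,dt\le\epsilon_T^2,\qquad \frac1{2\pi}\int_{\Omega^c}|\widehat f(\omega)|^2\,d\omega\le\epsilon_\Omega^2 .$$ For $c>0$ let $\lambda_0(c)\ge\lambda_1(c)\ge\cdots>0$ be the eigenvalues, in decreasing order and counted with multiplicity, of the operator $\mathcal Q_c f(x)=\int_{-1}^1\frac{\sin c(x-y)}{\pi(x-y)}f(y)\,dy$ on $L^2([-1,1])$, and let $(\psi_{n,c})_{n\ge0}$ be the corresponding orthonormal basis of $L^2([-1,1])$ of real eigenfunctions (the prolate spheroidal wave functions). Put $S_{N,c}f=\sum_{n<N}a_n\psi_{n,c}$ with $a_n=\int_{-1}^1 f\psi_{n,c}$,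 let $S_{N,c,a}f$ be the $N$-th partial sum ($n<N$) of the expansion of $f$ in the orthonormal basis $\frac1{\sqrt a}\psi_{n,c}(t/a)$ of $L^2([-a,a])$, and let $P_Tf=\chi_Tf$. (1) Let $c>0$ and let $f$ be $L^2$-normalized, $\epsilon_T$-concentrated in $T=[-1,1]$ and $\epsilon_\Omega$-band concentrated in $\Omega=[-c,c]$. Then for every positive integer $N$, $$\Big(\int_{-1}^1|f-S_{N,c}f|^2\,dt\Big)^{1/2}\le\epsilon_\Omega+\sqrt{\lambda_N(c)}\qquad\text{and}\qquad \|f-P_TS_{N,c}f\|_2\le\epsilon_T+\epsilon_\Omega+\sqrt{\lambda_N(c)} .$$ (2) More generally, let $a,b>0$, $c=ab$, and let $f$ be $L^2$-normalized, $\epsilon_T$-concentrated in $T=[-a,a]$ and $\epsilon_\Omega$-band concentrated in $\Omega=[-b,b]$. Then for every positive integer $N$, $$\Big(\int_{-a}^a|f-S_{N,c,a}f|^2\,dt\Big)^{1/2}\le\epsilon_\Omega+\sqrt{\lambda_N(c)}\qquad\text{and}\qquad \|f-P_TS_{N,c,a}f\|_2\le\epsilon_T+\epsilon_\Omega+\sqrt{\lambda_N(c)}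 .$$ -/

import Mathlib

namespace PSWF

open MeasureTheory Set Module.End
open scoped RealInnerProductSpace FourierTransform

/-- The kernel `sin (c (x - y)) / (π (x - y))`, with its continuous value `c / π` at `x = y`. -/
noncomputable def sincKernel (c x y : ℝ) : ℝ := c / Real.pi * Real.sinc (c * (x - y))

/-- The operator `𝒬_c f (x) = ∫_{-1}^{1} sin (c (x - y)) / (π (x - y)) f (y) dy`, with `x` ranging
over the whole line. -/
noncomputable def sincOp (c : ℝ) (f : ℝ → ℝ) (x : ℝ) : ℝ :=
  ∫ y in Icc (-1 : ℝ) 1, sincKernel c x y * f y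

/-- `ψ n` (`n = 0, 1, 2, …`) are the prolate spheroidal wave functions with bandwidth `c` and
`lam n` are the eigenvalues of `𝒬_c`: the `ψ n` form an orthonormal basis of `L²([-1, 1])` that
consists of eigenfunctions of `𝒬_c`, enumerated in decreasing order of the eigenvalues (with
multiplicity). Each `ψ n` is extended from `[-1, 1]` to the line by its eigenvalue equation, and its
sign is normalized at the origin. -/
structure IsPSWFSystem (c : ℝ) (ψ : ℕ → ℝ → ℝ) (lam : ℕ → ℝ) : Prop where
  continuous : ∀ n, Continuous (ψ n)
  orthonormal : ∀ m n, ∫ t in Icc (-1 : ℝ) 1, ψ m t * ψ n t = if m = n then 1 else 0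
  complete : ∀ g : ℝ → ℝ, MemLp g 2 (volume.restrict (Icc (-1 : ℝ) 1)) →
    (∀ n, ∫ t in Icc (-1 : ℝ) 1, g t * ψ n t = 0) → g =ᵐ[volume.restrict (Icc (-1 : ℝ) 1)] 0
  eigen : ∀ n x, sincOp c (ψ n) x = lam n * ψ n x
  pos : ∀ n, 0 < lam n
  antitone : Antitone lam
  sign_even : ∀ n, Even n → 0 ≤ ψ n 0
  sign_odd : ∀ n, Odd n → 0 ≤ deriv (ψ n) 0

/-! Existence of the prolate spheroidal wave functions: the spectral theorem for `𝒬_c`. -/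

theorem exists_top_eigenvector {H : Type*} [NormedAddCommGroup H] [InnerProductSpace ℝ H]
    [CompleteSpace H] [Nontrivial H] (S : H →L[ℝ] H) (hc : IsCompactOperator S)
    (hs : S.IsSymmetric) (hpos : ∀ x, x ≠ 0 → 0 < ⟪S x, x⟫) :
    ∃ u : H, ∃ l : ℝ, ‖u‖ = 1 ∧ 0 < l ∧ S u = l • u ∧ ∀ w, ‖S w‖ ≤ l * ‖w‖ := by
  have hS : S ≠ 0 := by
    rintro rfl
    obtain ⟨x, hx⟩ := exists_ne (0 : H)
    simpa using hpos x hx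
  have hne : (spectrum ℝ S).Nonempty := by
    by_contra h
    rw [Set.not_nonempty_iff_eq_empty] at h
    refine hS ((S.eq_zero_of_forall_hasEigenvalue_eq_zero hc hs).1 fun m hm => ?_)
    by_contra hm0
    have := (hc.hasEigenvalue_iff_mem_spectrum hm0).1 hm
    simp [h] at this
  obtain ⟨k, hk, hk'⟩ := spectrum.exists_nnnorm_eq_spectralRadius_of_nonempty hne
  rw [S.spectralRadius_eq_nnnorm hs.isSelfAdjoint] at hk'
  have hkn : ‖k‖ = ‖S‖ := by
    have := ENNReal.coe_injective hk'
    exact congrArg NNReal.toReal this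
  have hk0 : k ≠ 0 := by
    rintro rfl
    simp at hkn
    exact hS (norm_eq_zero.1 hkn.symm)
  have hev := (hc.hasEigenvalue_iff_mem_spectrum hk0).2 hk
  obtain ⟨v, hv⟩ := hev.exists_hasEigenvector
  have hSv : S v = k • v := hv.apply_eq_smul
  have hv0 : v ≠ 0 := hv.2
  have hvn : 0 < ‖v‖ := norm_pos_iff.2 hv0
  have hkpos : 0 < k := by
    have := hpos v hv0
    rw [hSv, real_inner_smul_left, real_inner_self_eq_norm_sq] at this
    exact pos_of_mul_pos_left this (by positivity)
  refine ⟨‖v‖⁻¹ • v, k, ?_, hkpos, ?_, fun w => ?_⟩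
  · rw [norm_smul, norm_inv, norm_norm, inv_mul_cancel₀ hvn.ne']
  · rw [map_smul, hSv, smul_comm]
  · have : k = ‖S‖ := by rw [← hkn, Real.norm_of_nonneg hkpos.le]
    rw [this]; exact S.le_opNorm w

theorem exists_next {H : Type*} [NormedAddCommGroup H] [InnerProductSpace ℝ H]
    [CompleteSpace H] (T : H →L[ℝ] H) (hc : IsCompactOperator T)
    (hs : T.IsSymmetric) (hpos : ∀ x, x ≠ 0 → 0 < ⟪T x, x⟫) (hinf : ¬ FiniteDimensional ℝ H)
    (V : Submodule ℝ H) (hV : FiniteDimensional ℝ V) (hTV : ∀ x ∈ V, T x ∈ V) :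
    ∃ u : H, ∃ l : ℝ, u ∈ Vᗮ ∧ ‖u‖ = 1 ∧ 0 < l ∧ T u = l • u ∧ ∀ w ∈ Vᗮ, ‖T w‖ ≤ l * ‖w‖ := by
  have hinv : ∀ x ∈ Vᗮ, T x ∈ Vᗮ := by
    intro x hx y hy
    have : ⟪T y, x⟫ = ⟪y, T x⟫ := hs y x
    rw [← this]
    exact hx _ (hTV y hy)
  have hnt : Nontrivial Vᗮ := by
    by_contra h
    rw [not_nontrivial_iff_subsingleton, Submodule.subsingleton_iff_eq_bot,
      Submodule.orthogonal_eq_bot_iff] at h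
    subst h
    exact hinf (Module.Finite.equiv (Submodule.topEquiv (R := ℝ) (M := H)))
  obtain ⟨u, l, h1, h2, h3, h4⟩ := exists_top_eigenvector (T.restrict hinv)
    (hc.restrict' hinv) (hs.restrict_invariant hinv)
    (fun x hx => hpos x (by simpa using hx))
  refine ⟨u, l, u.2, h1, h2, congrArg Subtype.val h3, fun w hw => h4 ⟨w, hw⟩⟩

theorem exists_eigenbasis {H : Type*} [NormedAddCommGroup H] [InnerProductSpace ℝ H]
    [CompleteSpace H] (T : H →L[ℝ] H) (hc : IsCompactOperator T)
    (hs : T.IsSymmetric) (hpos : ∀ x, x ≠ 0 → 0 < ⟪T x, x⟫) (hinf : ¬ FiniteDimensional ℝ H) :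
    ∃ (v : ℕ → H) (l : ℕ → ℝ), Orthonormal ℝ v ∧ (∀ n, T (v n) = l n • v n) ∧ (∀ n, 0 < l n) ∧
      Antitone l ∧ ∀ g : H, (∀ n, ⟪v n, g⟫ = 0) → g = 0 := by
  let X := {V : Submodule ℝ H // FiniteDimensional ℝ V ∧ ∀ x ∈ V, T x ∈ V}
  choose U L hU using fun V : X => exists_next T hc hs hpos hinf V.1 V.2.1 V.2.2
  let next : X → X := fun V => ⟨V.1 ⊔ Submodule.span ℝ {U V}, by
    have := V.2.1
    refine ⟨inferInstance, fun x hx => ?_⟩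
    obtain ⟨y, hy, z, hz, rfl⟩ := Submodule.mem_sup.1 hx
    obtain ⟨a, rfl⟩ := Submodule.mem_span_singleton.1 hz
    rw [map_add, map_smul, (hU V).2.2.2.1]
    exact Submodule.add_mem_sup (V.2.2 y hy)
      (Submodule.smul_mem _ _ (Submodule.smul_mem _ _ (Submodule.mem_span_singleton_self _)))⟩
  let V : ℕ → X := fun n => Nat.rec ⟨⊥, inferInstance, by simp⟩ (fun _ W => next W) n
  have hV0 : (V 0).1 = ⊥ := rfl
  have hVs : ∀ n, (V (n + 1)).1 = (V n).1 ⊔ Submodule.span ℝ {U (V n)} := fun n => rfl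
  have hmono : Monotone fun n => (V n).1 :=
    monotone_nat_of_le_succ fun n => by rw [hVs]; exact le_sup_left
  have hmem : ∀ m n, m < n → U (V m) ∈ (V n).1 := by
    intro m n h
    refine hmono (Nat.succ_le_of_lt h) ?_
    change U (V m) ∈ (V (m + 1)).1
    rw [hVs]
    exact Submodule.mem_sup_right (Submodule.mem_span_singleton_self _)
  have hlt : ∀ m n, m < n → ⟪U (V m), U (V n)⟫ = 0 := fun m n h =>
    (hU (V n)).1 _ (hmem m n h)
  have horth : ∀ m n, m ≠ n → ⟪U (V m), U (V n)⟫ = 0 := by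
    intro m n h
    rcases lt_or_gt_of_ne h with h | h
    · exact hlt m n h
    · rw [real_inner_comm]; exact hlt n m h
  have hperp : ∀ g : H, (∀ n, ⟪U (V n), g⟫ = 0) → ∀ n, g ∈ ((V n).1)ᗮ := by
    intro g hg n
    induction n with
    | zero => rw [hV0]; simp
    | succ n ih =>
      rw [hVs, ← Submodule.inf_orthogonal]
      exact ⟨ih, (Submodule.mem_orthogonal_singleton_iff_inner_right).2 (hg n)⟩
  have hanti : Antitone fun n => L (V n) := by
    refine antitone_nat_of_succ_le fun n => ?_
    obtain ⟨a1, a2, a3, a4, -⟩ := hU (V (n + 1))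
    have := (hU (V n)).2.2.2.2 _ (Submodule.orthogonal_le (hmono (Nat.le_succ n)) a1)
    rw [a4, norm_smul, a2, Real.norm_of_nonneg a3.le] at this
    simpa using this
  refine ⟨fun n => U (V n), fun n => L (V n), ⟨fun n => (hU (V n)).2.1, fun m n h => horth m n h⟩,
    fun n => (hU (V n)).2.2.2.1, fun n => (hU (V n)).2.2.1, hanti, fun g hg => ?_⟩
  have hbd : ∀ n, ‖T g‖ ≤ L (V n) * ‖g‖ := fun n => (hU (V n)).2.2.2.2 g (hperp g hg n)
  by_contra hg0
  have hTg : 0 < ‖T g‖ := by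
    rw [norm_pos_iff]
    intro h
    have := hpos g hg0
    simp [h] at this
  have hgn : 0 < ‖g‖ := norm_pos_iff.2 hg0
  set d := ‖T g‖ / ‖g‖ with hd
  have hdpos : 0 < d := by positivity
  have hdL : ∀ n, d ≤ L (V n) := fun n => by rw [hd, div_le_iff₀ hgn]; exact hbd n
  obtain ⟨K, hK, hsub⟩ := hc.image_closedBall_subset_compact 1
  have hinK : ∀ n, T (U (V n)) ∈ K := fun n =>
    hsub ⟨U (V n), by simp [(hU (V n)).2.1], rfl⟩
  obtain ⟨x, -, φ, hφ, hx⟩ := hK.tendsto_subseq hinK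
  have hcau := hx.cauchySeq
  rw [Metric.cauchySeq_iff] at hcau
  obtain ⟨N, hN⟩ := hcau d hdpos
  have h1 := hN N le_rfl (N + 1) (Nat.le_succ N)
  have hne : φ N ≠ φ (N + 1) := (hφ (Nat.lt_succ_self N)).ne
  have h2 : dist ((fun n => T (U (V n))) (φ N)) ((fun n => T (U (V n))) (φ (N + 1))) ^ 2
      = L (V (φ N)) ^ 2 + L (V (φ (N + 1))) ^ 2 := by
    simp only
    rw [dist_eq_norm, (hU _).2.2.2.1, (hU _).2.2.2.1, norm_sub_sq_real, real_inner_smul_left,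
      real_inner_smul_right, horth _ _ hne, norm_smul, norm_smul, (hU _).2.1, (hU _).2.1]
    simp
  simp only [Function.comp] at h1
  have h3 := hdL (φ N)
  have h4 : 0 ≤ dist (T (U (V (φ N)))) (T (U (V (φ (N + 1))))) := dist_nonneg
  simp only at h2
  nlinarith [sq_nonneg (L (V (φ (N + 1)))), mul_self_nonneg d]

theorem sincKernel_eq_integral {c : ℝ} (hc : 0 < c) (x y : ℝ) :
    sincKernel c x y = ∫ w in (0 : ℝ)..c, Real.pi⁻¹ *
      (Real.cos (w * x) * Real.cos (w * y) + Real.sin (w * x) * Real.sin (w * y)) := by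
  have : ∀ w : ℝ, Real.cos (w * x) * Real.cos (w * y) + Real.sin (w * x) * Real.sin (w * y)
      = Real.cos ((x - y) * w) := fun w => by rw [← Real.cos_sub]; ring_nf
  simp_rw [this]
  rw [intervalIntegral.integral_const_mul, sincKernel]
  by_cases h : x - y = 0
  · simp [h]; field_simp
  · rw [intervalIntegral.integral_comp_mul_left (fun t => Real.cos t) h, integral_cos,
      Real.sinc_of_ne_zero (mul_ne_zero hc.ne' h)]
    simp only [mul_zero, Real.sin_zero, sub_zero, smul_eq_mul]
    rw [mul_comm (x - y) c]
    field_simp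

/-- Lebesgue measure on `[-1, 1]`. -/
noncomputable def muI : Measure ℝ := volume.restrict (Icc (-1 : ℝ) 1)

instance : IsFiniteMeasure muI := by unfold muI; infer_instance

theorem memLp_muI {f : ℝ → ℝ} (hf : Continuous f) : MemLp f 2 muI := by
  unfold muI
  obtain ⟨C, hC⟩ := isCompact_Icc.exists_bound_of_continuousOn
    (hf.continuousOn (s := Icc (-1 : ℝ) 1))
  refine MemLp.of_bound hf.aestronglyMeasurable C ?_
  filter_upwards [ae_restrict_mem measurableSet_Icc] with x hx using hC x hx

/-- A continuous function as a vector of `L²(-1, 1)`. -/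
noncomputable def contLp (f : ℝ → ℝ) (hf : Continuous f) : Lp ℝ 2 muI := (memLp_muI hf).toLp f

theorem contLp_ae (f : ℝ → ℝ) (hf : Continuous f) : contLp f hf =ᵐ[muI] f :=
  (memLp_muI hf).coeFn_toLp

theorem inner_contLp (f : ℝ → ℝ) (hf : Continuous f) (g : Lp ℝ 2 muI) :
    ⟪contLp f hf, g⟫ = ∫ y, f y * g y ∂muI := by
  rw [L2.inner_def]
  refine integral_congr_ae ?_
  filter_upwards [contLp_ae f hf] with y hy
  rw [hy]; simp [mul_comm]

theorem lp_integrable (g : Lp ℝ 2 muI) : Integrable g muI :=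
  (Lp.memLp g).integrable (by norm_num)

/-- A Lipschitz family of functions gives a continuous family of vectors. -/
theorem continuous_contLp (F : ℝ → ℝ → ℝ) (hF : ∀ w, Continuous (F w))
    (h : ∀ w w' x, x ∈ Icc (-1 : ℝ) 1 → |F w x - F w' x| ≤ |w - w'|) :
    Continuous fun w => contLp (F w) (hF w) := by
  let C := muI.real univ ^ ((2 : ENNReal).toReal)⁻¹
  have hC : 0 ≤ C := by positivity
  refine (LipschitzWith.of_dist_le_mul (K := ⟨C, hC⟩) fun w w' => ?_).continuous
  rw [dist_eq_norm, contLp, contLp, ← MemLp.toLp_sub]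
  refine (Lp.norm_le_of_ae_bound (C := |w - w'|) (abs_nonneg _) ?_).trans (le_of_eq ?_)
  · filter_upwards [MemLp.coeFn_toLp ((memLp_muI (hF w)).sub (memLp_muI (hF w'))),
      (ae_restrict_mem measurableSet_Icc : ∀ᵐ x ∂muI, x ∈ Icc (-1 : ℝ) 1)] with x h1 h2
    rw [h1]
    exact h w w' x h2
  · rfl

theorem cos_cont (w : ℝ) : Continuous fun x : ℝ => Real.cos (w * x) := by fun_prop
theorem sin_cont (w : ℝ) : Continuous fun x : ℝ => Real.sin (w * x) := by fun_prop

noncomputable def cosLp (w : ℝ) : Lp ℝ 2 muI := contLp _ (cos_cont w)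
noncomputable def sinLp (w : ℝ) : Lp ℝ 2 muI := contLp _ (sin_cont w)

theorem mul_dist_le (w w' x : ℝ) (hx : x ∈ Icc (-1 : ℝ) 1) : |w * x - w' * x| ≤ |w - w'| := by
  rw [← sub_mul, abs_mul]
  exact mul_le_of_le_one_right (abs_nonneg _) (abs_le.2 hx)

theorem continuous_cosLp : Continuous cosLp :=
  continuous_contLp (fun w x => Real.cos (w * x)) cos_cont fun w w' x hx =>
    (Real.abs_cos_sub_cos_le _ _).trans (mul_dist_le w w' x hx)

theorem continuous_sinLp : Continuous sinLp :=
  continuous_contLp (fun w x => Real.sin (w * x)) sin_cont fun w w' x hx =>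
    (Real.abs_sin_sub_sin_le _ _).trans (mul_dist_le w w' x hx)

/-- The rank-two operators whose average is the sinc kernel operator. -/
noncomputable def rkOp (w : ℝ) : Lp ℝ 2 muI →L[ℝ] Lp ℝ 2 muI :=
  Real.pi⁻¹ • (InnerProductSpace.rankOne ℝ (cosLp w) (cosLp w) +
    InnerProductSpace.rankOne ℝ (sinLp w) (sinLp w))

theorem continuous_rkOp : Continuous rkOp := by
  unfold rkOp
  have h : ∀ f : ℝ → Lp ℝ 2 muI, Continuous f →
      Continuous fun w => InnerProductSpace.rankOne ℝ (f w) (f w) := fun f hf =>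
    ((InnerProductSpace.rankOne ℝ (E := Lp ℝ 2 muI) (F := Lp ℝ 2 muI)).continuous.comp hf).clm_apply hf
  exact ((h _ continuous_cosLp).add (h _ continuous_sinLp)).const_smul (Real.pi⁻¹)

/-- The sinc kernel operator on `L²(-1, 1)`, as an average of rank-two operators. -/
noncomputable def sincLp (c : ℝ) : Lp ℝ 2 muI →L[ℝ] Lp ℝ 2 muI := ∫ w in (0 : ℝ)..c, rkOp w

theorem rkOp_compact (w : ℝ) : IsCompactOperator (rkOp w) := by
  have h : ∀ v : Lp ℝ 2 muI, IsCompactOperator (InnerProductSpace.rankOne ℝ v v) := by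
    intro v
    have : ⇑(InnerProductSpace.rankOne ℝ v v) =
        (ContinuousLinearMap.toSpanSingleton ℝ v) ∘ (innerSL ℝ v) := by
      ext1 x; simp
    rw [this]
    have hd : IsCompactOperator (ContinuousLinearMap.toSpanSingleton ℝ v) :=
      isCompactOperator_of_locallyCompactSpace_rng _
    exact hd.comp_clm (innerSL ℝ v)
  exact ((h (cosLp w)).add (h (sinLp w))).smul (Real.pi⁻¹)

theorem sincLp_compact {c : ℝ} (hc : 0 < c) : IsCompactOperator (sincLp c) := by
  let K : Submodule ℝ (Lp ℝ 2 muI →L[ℝ] Lp ℝ 2 muI) :=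
    compactOperator (RingHom.id ℝ) (Lp ℝ 2 muI) (Lp ℝ 2 muI)
  have hK : IsClosed (K : Set (Lp ℝ 2 muI →L[ℝ] Lp ℝ 2 muI)) :=
    isClosed_setOfPred_isCompactOperator
  have hmem : ∀ s : Set ℝ, IsFiniteMeasure (volume.restrict s) → s = Ioc 0 c →
      ∫ w in s, rkOp w ∈ K := by
    intro s hs hsc
    have hne : NeZero (volume.restrict s) := ⟨by
      rw [Ne, Measure.restrict_eq_zero, hsc, Real.volume_Ioc]; simp [hc]⟩
    have hint : Integrable rkOp (volume.restrict s) := by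
      rw [hsc]
      exact (continuous_rkOp.integrableOn_Icc (a := 0) (b := c)).mono_set Ioc_subset_Icc_self
    have h1 := K.convex.average_mem hK (μ := volume.restrict s) (f := rkOp)
      (Filter.Eventually.of_forall fun w => rkOp_compact w) hint
    have h2 := measure_smul_average (volume.restrict s) rkOp
    rw [← h2]
    exact K.smul_mem _ h1
  have := hmem (Ioc 0 c) inferInstance rfl
  rw [← intervalIntegral.integral_of_le hc.le] at this
  exact this

theorem rkOp_inner (w : ℝ) (g h : Lp ℝ 2 muI) :
    ⟪rkOp w g, h⟫ = Real.pi⁻¹ * (⟪cosLp w, g⟫ * ⟪cosLp w, h⟫ + ⟪sinLp w, g⟫ * ⟪sinLp w, h⟫) := by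
  simp [rkOp, inner_add_left, real_inner_smul_left, mul_add]

theorem sincLp_inner (c : ℝ) (g h : Lp ℝ 2 muI) :
    ⟪sincLp c g, h⟫ = ∫ w in (0 : ℝ)..c,
      Real.pi⁻¹ * (⟪cosLp w, g⟫ * ⟪cosLp w, h⟫ + ⟪sinLp w, g⟫ * ⟪sinLp w, h⟫) := by
  let A : (Lp ℝ 2 muI →L[ℝ] Lp ℝ 2 muI) →L[ℝ] ℝ :=
    (innerSL ℝ h).comp (ContinuousLinearMap.apply ℝ (Lp ℝ 2 muI) g)
  have hA : ∀ S, A S = ⟪S g, h⟫ := fun S => by simp [A, real_inner_comm]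
  have := A.intervalIntegral_comp_comm (μ := volume) (continuous_rkOp.intervalIntegrable 0 c)
  rw [← hA, sincLp, ← this]
  simp_rw [hA, rkOp_inner]

theorem sincLp_symm (c : ℝ) : (sincLp c).IsSymmetric := by
  intro g h
  change ⟪sincLp c g, h⟫ = ⟪g, sincLp c h⟫
  rw [real_inner_comm (sincLp c h), sincLp_inner, sincLp_inner]
  refine intervalIntegral.integral_congr fun w _ => ?_
  ring

/-- Fubini for products of an integrable function with a continuous bounded kernel. -/
theorem swap_aux {c : ℝ} (hc : 0 < c) (F : ℝ → ℝ → ℝ) (hF : Continuous fun p : ℝ × ℝ => F p.1 p.2)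
    (hb : ∀ w y, |F w y| ≤ 1) (g : Lp ℝ 2 muI) :
    ∫ w in (0 : ℝ)..c, ∫ y, F w y * g y ∂muI = ∫ y, (∫ w in (0 : ℝ)..c, F w y) * g y ∂muI := by
  simp_rw [intervalIntegral.integral_of_le hc.le]
  rw [integral_integral_swap]
  · simp_rw [integral_mul_const]
  · have h1 : Integrable (fun p : ℝ × ℝ => g p.2) ((volume.restrict (Ioc 0 c)).prod muI) :=
      (lp_integrable g).comp_snd _
    exact h1.bdd_mul (c := 1) hF.aestronglyMeasurable
      (Filter.Eventually.of_forall fun p => hb p.1 p.2)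

theorem trig_bound (a b : ℝ) :
    |Real.cos a * Real.cos b + Real.sin a * Real.sin b| ≤ 1 := by
  rw [← Real.cos_sub]; exact Real.abs_cos_le_one _

theorem sincOp_eq {c : ℝ} (hc : 0 < c) (g : Lp ℝ 2 muI) (x : ℝ) :
    sincOp c g x = ∫ w in (0 : ℝ)..c, Real.pi⁻¹ *
      (Real.cos (w * x) * ⟪cosLp w, g⟫ + Real.sin (w * x) * ⟪sinLp w, g⟫) := by
  have hpi : Real.pi⁻¹ ≤ 1 := inv_le_one_of_one_le₀ (by linarith [Real.pi_gt_three])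
  have := swap_aux hc (fun w y => Real.pi⁻¹ *
      (Real.cos (w * x) * Real.cos (w * y) + Real.sin (w * x) * Real.sin (w * y)))
      (by fun_prop) (fun w y => by
        rw [abs_mul, abs_of_pos (by positivity)]
        exact mul_le_one₀ hpi (abs_nonneg _) (trig_bound _ _)) g
  unfold sincOp
  simp_rw [sincKernel_eq_integral hc]
  refine Eq.trans this.symm (intervalIntegral.integral_congr fun w _ => ?_)
  rw [cosLp, sinLp, inner_contLp, inner_contLp, ← integral_const_mul, ← integral_const_mul,
    ← integral_add, ← integral_const_mul]
  · refine integral_congr_ae (Filter.Eventually.of_forall fun y => ?_)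
    beta_reduce; ring
  · refine ((lp_integrable g).bdd_mul (c := 1) (cos_cont w).aestronglyMeasurable
      (Filter.Eventually.of_forall fun p => Real.abs_cos_le_one _)).const_mul _
  · refine ((lp_integrable g).bdd_mul (c := 1) (sin_cont w).aestronglyMeasurable
      (Filter.Eventually.of_forall fun p => Real.abs_sin_le_one _)).const_mul _

theorem continuous_sincOp {c : ℝ} (hc : 0 < c) (g : Lp ℝ 2 muI) : Continuous (sincOp c g) := by
  have : sincOp c g = fun x => ∫ w in (0 : ℝ)..c, Real.pi⁻¹ *
      (Real.cos (w * x) * ⟪cosLp w, g⟫ + Real.sin (w * x) * ⟪sinLp w, g⟫) :=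
    funext (sincOp_eq hc g)
  rw [this]
  have h1 : Continuous fun w => ⟪cosLp w, g⟫ := continuous_cosLp.inner continuous_const
  have h2 : Continuous fun w => ⟪sinLp w, g⟫ := continuous_sinLp.inner continuous_const
  refine intervalIntegral.continuous_parametric_intervalIntegral_of_continuous' ?_ 0 c
  simp only [Function.uncurry_def]
  have h3 := h1.comp (continuous_snd (X := ℝ) (Y := ℝ))
  have h4 := h2.comp (continuous_snd (X := ℝ) (Y := ℝ))
  simp only [Function.comp_def] at h3 h4
  fun_prop

theorem sincLp_ae {c : ℝ} (hc : 0 < c) (g : Lp ℝ 2 muI) : sincLp c g =ᵐ[muI] sincOp c g := by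
  have hq := continuous_sincOp hc g
  suffices sincLp c g = contLp _ hq by rw [this]; exact contLp_ae _ hq
  refine ext_inner_right ℝ fun h => ?_
  have h1 : Continuous fun w => ⟪cosLp w, g⟫ := continuous_cosLp.inner continuous_const
  have h2 : Continuous fun w => ⟪sinLp w, g⟫ := continuous_sinLp.inner continuous_const
  rw [sincLp_inner, inner_contLp]
  simp_rw [sincOp_eq hc]
  have swap2 : ∀ F : ℝ → ℝ → ℝ, (Continuous fun p : ℝ × ℝ => F p.1 p.2) →
      ∫ w in (0 : ℝ)..c, ∫ y, F w y * h y ∂muI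
        = ∫ y, (∫ w in (0 : ℝ)..c, F w y) * h y ∂muI := by
    intro F hF
    simp_rw [intervalIntegral.integral_of_le hc.le]
    rw [integral_integral_swap]
    · simp_rw [integral_mul_const]
    · have h1 : Integrable (fun p : ℝ × ℝ => h p.2) ((volume.restrict (Ioc 0 c)).prod muI) :=
        (lp_integrable h).comp_snd _
      obtain ⟨C, hC⟩ := (isCompact_Icc.prod isCompact_Icc : IsCompact
        (Icc (0 : ℝ) c ×ˢ Icc (-1 : ℝ) 1)).exists_bound_of_continuousOn hF.continuousOn
      refine h1.bdd_mul (c := C) hF.aestronglyMeasurable ?_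
      unfold muI
      rw [Measure.prod_restrict]
      filter_upwards [ae_restrict_mem (measurableSet_Ioc.prod measurableSet_Icc)] with p hp
      exact hC p ⟨Ioc_subset_Icc_self hp.1, hp.2⟩
  rw [← swap2]
  · refine intervalIntegral.integral_congr fun w _ => ?_
    rw [cosLp, sinLp, inner_contLp _ _ h, inner_contLp _ _ h, ← integral_const_mul,
      ← integral_const_mul, ← integral_add, ← integral_const_mul]
    · refine integral_congr_ae (Filter.Eventually.of_forall fun y => ?_)
      beta_reduce; ring
    · refine ((lp_integrable h).bdd_mul (c := 1) (cos_cont w).aestronglyMeasurable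
        (Filter.Eventually.of_forall fun p => Real.abs_cos_le_one _)).const_mul _
    · refine ((lp_integrable h).bdd_mul (c := 1) (sin_cont w).aestronglyMeasurable
        (Filter.Eventually.of_forall fun p => Real.abs_sin_le_one _)).const_mul _
  · have h3 := h1.comp (continuous_fst (X := ℝ) (Y := ℝ))
    have h4 := h2.comp (continuous_fst (X := ℝ) (Y := ℝ))
    simp only [Function.comp_def] at h3 h4
    fun_prop

theorem ae_zero_of_trig {c : ℝ} (hc : 0 < c) (g : Lp ℝ 2 muI)
    (h1 : ∀ w ∈ Ioo 0 c, ⟪cosLp w, g⟫ = 0) (h2 : ∀ w ∈ Ioo 0 c, ⟪sinLp w, g⟫ = 0) : g = 0 := by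
  have hgi := lp_integrable g
  have hgm : AEMeasurable g muI := hgi.aestronglyMeasurable.aemeasurable
  let P : Measure ℝ := muI.withDensity fun y => ENNReal.ofReal (g y)
  let Q : Measure ℝ := muI.withDensity fun y => ENNReal.ofReal (-g y)
  have hP : IsFiniteMeasure P := isFiniteMeasure_withDensity_ofReal hgi.2
  have hQ : IsFiniteMeasure Q := isFiniteMeasure_withDensity_ofReal hgi.neg.2
  have hsupp : ∀ (q : ℝ → ENNReal), ∀ᵐ y ∂(muI.withDensity q), y ∈ Icc (-1 : ℝ) 1 := fun q =>
    (withDensity_absolutelyContinuous muI q).ae_le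
      (ae_restrict_mem measurableSet_Icc : ∀ᵐ y ∂muI, y ∈ Icc (-1 : ℝ) 1)
  have hexp : ∀ q : ℝ → ENNReal, IsFiniteMeasure (muI.withDensity q) →
      ProbabilityTheory.integrableExpSet id (muI.withDensity q) = univ := by
    intro q hq
    refine eq_univ_of_forall fun t => ?_
    refine Integrable.of_bound (C := Real.exp |t|) (by fun_prop) ?_
    filter_upwards [hsupp q] with y hy
    rw [Real.norm_of_nonneg (Real.exp_pos _).le]
    refine Real.exp_le_exp.2 ((le_abs_self _).trans ?_)
    rw [abs_mul]
    exact mul_le_of_le_one_right (abs_nonneg _) (abs_le.2 hy)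
  have han : ∀ q : ℝ → ENNReal, IsFiniteMeasure (muI.withDensity q) →
      AnalyticOnNhd ℂ (ProbabilityTheory.complexMGF id (muI.withDensity q)) univ := by
    intro q hq
    have := ProbabilityTheory.analyticOnNhd_complexMGF (X := id) (μ := muI.withDensity q)
    simpa [hexp q hq] using this
  have hcos : ∀ w, Integrable (fun y => Real.cos (w * y) * g y) muI := fun w =>
    hgi.bdd_mul (c := 1) (cos_cont w).aestronglyMeasurable
      (Filter.Eventually.of_forall fun p => Real.abs_cos_le_one _)
  have hsin : ∀ w, Integrable (fun y => Real.sin (w * y) * g y) muI := fun w =>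
    hgi.bdd_mul (c := 1) (sin_cont w).aestronglyMeasurable
      (Filter.Eventually.of_forall fun p => Real.abs_sin_le_one _)
  have hden : ∀ (s : ℝ → ℝ), AEMeasurable s muI → ∀ w : ℝ,
      ProbabilityTheory.complexMGF id (muI.withDensity fun y => ENNReal.ofReal (s y))
        (w * Complex.I) = ∫ y, ((max (s y) 0 : ℝ) : ℂ) * Complex.exp (w * y * Complex.I) ∂muI := by
    intro s hs w
    rw [ProbabilityTheory.complexMGF,
      integral_withDensity_eq_integral_toReal_smul₀ hs.ennreal_ofReal
        (Filter.Eventually.of_forall fun _ => ENNReal.ofReal_lt_top)]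
    refine integral_congr_ae (Filter.Eventually.of_forall fun y => ?_)
    simp only [ENNReal.toReal_ofReal', id, Complex.real_smul]
    congr 2; ring
  have hbdd : ∀ s : ℝ → ℝ, Integrable s muI → ∀ w : ℝ,
      Integrable (fun y => ((s y : ℝ) : ℂ) * Complex.exp (w * y * Complex.I)) muI := by
    intro s hs w
    refine hs.ofReal.mul_bdd (c := 1) (by fun_prop) (Filter.Eventually.of_forall fun y => ?_)
    have := Complex.norm_exp_ofReal_mul_I (w * y)
    push_cast at this
    exact this.le
  have heq : ∀ w ∈ Ioo 0 c, ProbabilityTheory.complexMGF id P (w * Complex.I)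
      = ProbabilityTheory.complexMGF id Q (w * Complex.I) := by
    intro w hw
    rw [hden _ hgm, hden (fun y => -g y) hgm.neg, ← sub_eq_zero, ← integral_sub
      (hbdd _ hgi.pos_part w) (hbdd _ hgi.neg_part w)]
    have e1 := h1 w hw
    have e2 := h2 w hw
    rw [cosLp, inner_contLp] at e1
    rw [sinLp, inner_contLp] at e2
    have : ∀ y : ℝ, ((max (g y) 0 : ℝ) : ℂ) * Complex.exp (w * y * Complex.I) -
        ((max (-g y) 0 : ℝ) : ℂ) * Complex.exp (w * y * Complex.I) =
        ((Real.cos (w * y) * g y : ℝ) : ℂ) + ((Real.sin (w * y) * g y : ℝ) : ℂ) * Complex.I := by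
      intro y
      rw [← sub_mul, ← Complex.ofReal_sub, max_zero_sub_max_neg_zero_eq_self, Complex.exp_mul_I]
      push_cast; ring
    simp_rw [this]
    rw [integral_add (hcos w).ofReal ((hsin w).ofReal.mul_const _), integral_mul_const,
      integral_complex_ofReal, integral_complex_ofReal, e1, e2]
    simp
  have hall : ProbabilityTheory.complexMGF id P = ProbabilityTheory.complexMGF id Q := by
    have := AnalyticOnNhd.eqOn_of_preconnected_of_frequently_eq (han _ hP) (han _ hQ)
      isPreconnected_univ (mem_univ (((c / 2 : ℝ) : ℂ) * Complex.I)) ?_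
    · exact funext fun z => this (mem_univ z)
    · have ht : Filter.Tendsto (fun n : ℕ => ((c / 2 + c / 4 * (1 / ((n : ℝ) + 1)) : ℝ) : ℂ)
          * Complex.I) Filter.atTop (nhdsWithin (((c / 2 : ℝ) : ℂ) * Complex.I)
            {((c / 2 : ℝ) : ℂ) * Complex.I}ᶜ) := by
        refine tendsto_nhdsWithin_iff.2 ⟨?_, Filter.Eventually.of_forall fun n => ?_⟩
        · have h0 := ((tendsto_one_div_add_atTop_nhds_zero_nat (𝕜 := ℝ)).const_mul (c / 4)).const_add
            (c / 2)
          rw [mul_zero, add_zero] at h0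
          exact ((Complex.continuous_ofReal.tendsto _).comp h0).mul_const _
        · have hn : 0 < c / 4 * (1 / ((n : ℝ) + 1)) := by positivity
          simp only [mem_compl_iff, mem_singleton_iff]
          intro h
          have := mul_right_cancel₀ Complex.I_ne_zero h
          have := Complex.ofReal_injective this
          linarith
      refine ht.frequently (Filter.Eventually.frequently (Filter.Eventually.of_forall fun n => ?_))
      refine heq _ ⟨by positivity, ?_⟩
      have h3 : 1 / ((n : ℝ) + 1) ≤ 1 := by
        rw [div_le_one (by positivity)]; linarith [(Nat.cast_nonneg n : (0 : ℝ) ≤ n)]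
      nlinarith
  have hPQ : P = Q := Measure.ext_of_complexMGF_id_eq hall
  have hae := (withDensity_eq_iff_of_sigmaFinite hgm.ennreal_ofReal
    hgm.neg.ennreal_ofReal).1 hPQ
  rw [Lp.eq_zero_iff_ae_eq_zero]
  filter_upwards [hae] with y hy
  have h3 := congrArg ENNReal.toReal hy
  simp only [ENNReal.toReal_ofReal', Pi.neg_apply] at h3
  have h4 := max_zero_sub_max_neg_zero_eq_self (g y)
  rw [h3, sub_self] at h4
  exact h4.symm

theorem sincLp_pos {c : ℝ} (hc : 0 < c) (g : Lp ℝ 2 muI) (hg : g ≠ 0) : 0 < ⟪sincLp c g, g⟫ := by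
  have k1 : Continuous fun w => ⟪cosLp w, g⟫ := continuous_cosLp.inner continuous_const
  have k2 : Continuous fun w => ⟪sinLp w, g⟫ := continuous_sinLp.inner continuous_const
  rw [sincLp_inner]
  by_contra hle
  have hnn : ∀ w, 0 ≤ Real.pi⁻¹ * (⟪cosLp w, g⟫ * ⟪cosLp w, g⟫ + ⟪sinLp w, g⟫ * ⟪sinLp w, g⟫) :=
    fun w => mul_nonneg (by positivity) (add_nonneg (mul_self_nonneg _) (mul_self_nonneg _))
  have hz : ∀ w ∈ Ioo 0 c,
      Real.pi⁻¹ * (⟪cosLp w, g⟫ * ⟪cosLp w, g⟫ + ⟪sinLp w, g⟫ * ⟪sinLp w, g⟫) = 0 := by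
    intro w hw
    by_contra hne
    exact hle (intervalIntegral.integral_pos hc (by fun_prop) (fun x _ => hnn x)
      ⟨w, Ioo_subset_Icc_self hw, lt_of_le_of_ne (hnn w) (Ne.symm hne)⟩)
  refine hg (ae_zero_of_trig hc g (fun w hw => ?_) (fun w hw => ?_)) <;>
  · have h := hz w hw
    have hpi : Real.pi⁻¹ ≠ 0 := by positivity
    have := (mul_eq_zero.1 h).resolve_left hpi
    nlinarith [mul_self_nonneg ⟪cosLp w, g⟫, mul_self_nonneg ⟪sinLp w, g⟫]

theorem muI_ae_continuous {f : ℝ → ℝ} (hf : Continuous f) (h : f =ᵐ[muI] 0) :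
    ∀ x ∈ Icc (-1 : ℝ) 1, f x = 0 := by
  have := Measure.eqOn_Icc_of_ae_eq (μ := volume) (a := (-1 : ℝ)) (b := 1) (by norm_num)
    (f := f) (g := 0) h hf.continuousOn continuousOn_const
  exact this

theorem lp_infinite : ¬ FiniteDimensional ℝ (Lp ℝ 2 muI) := by
  intro hfin
  let A : Polynomial ℝ →ₗ[ℝ] Lp ℝ 2 muI :=
    { toFun := fun p => contLp (fun x => p.eval x) p.continuous
      map_add' := fun p q => by
        rw [contLp, contLp, contLp, ← MemLp.toLp_add]; congr 1; ext x; simp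
      map_smul' := fun r p => by
        rw [contLp, contLp, RingHom.id_apply, ← MemLp.toLp_const_smul]; congr 1; ext x; simp }
  have hinj : Function.Injective A := by
    rw [← LinearMap.ker_eq_bot, LinearMap.ker_eq_bot']
    intro p hp
    have h1 : (fun x => p.eval x) =ᵐ[muI] 0 :=
      (contLp_ae (fun x => p.eval x) p.continuous).symm.trans
        ((Lp.eq_zero_iff_ae_eq_zero).1 hp)
    have h2 := muI_ae_continuous p.continuous h1
    refine p.eq_zero_of_infinite_isRoot ((Icc_infinite (by norm_num : (-1 : ℝ) < 1)).mono ?_)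
    exact fun x hx => h2 x hx
  exact Polynomial.not_finite (R := ℝ) (Module.Finite.of_injective A hinj)

theorem exists_isPSWFSystem {c : ℝ} (hc : 0 < c) : ∃ ψ lam, IsPSWFSystem c ψ lam := by
  obtain ⟨v, l, hv, hTv, hl, hanti, hcomp⟩ := exists_eigenbasis (sincLp c) (sincLp_compact hc)
    (sincLp_symm c) (fun g hg => sincLp_pos hc g hg) lp_infinite
  let φ : ℕ → ℝ → ℝ := fun n x => (l n)⁻¹ * sincOp c (v n) x
  have hφc : ∀ n, Continuous (φ n) := fun n => (continuous_sincOp hc (v n)).const_mul _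
  have hφv : ∀ n, φ n =ᵐ[muI] v n := by
    intro n
    filter_upwards [sincLp_ae hc (v n), Lp.coeFn_smul (l n) (v n)] with x h1 h2
    rw [hTv, h2] at h1
    simp only [φ, ← h1, Pi.smul_apply, smul_eq_mul]
    rw [inv_mul_cancel_left₀ (hl n).ne']
  have hsgn : ∀ n, ∃ e : ℝ, e * e = 1 ∧ (Even n → 0 ≤ e * φ n 0) ∧
      (Odd n → 0 ≤ e * deriv (φ n) 0) := by
    intro n
    have key : ∀ r : ℝ, ∃ e : ℝ, e * e = 1 ∧ 0 ≤ e * r := fun r => by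
      rcases le_total 0 r with h | h
      · exact ⟨1, by norm_num, by simpa⟩
      · exact ⟨-1, by norm_num, by simpa⟩
    rcases Nat.even_or_odd n with h | h
    · obtain ⟨e, h1, h2⟩ := key (φ n 0)
      exact ⟨e, h1, fun _ => h2, fun h' => absurd h (Nat.not_even_iff_odd.2 h')⟩
    · obtain ⟨e, h1, h2⟩ := key (deriv (φ n) 0)
      exact ⟨e, h1, fun h' => absurd h' (Nat.not_even_iff_odd.2 h), fun _ => h2⟩
  choose e he heven hodd using hsgn
  refine ⟨fun n x => e n * φ n x, l, ⟨fun n => (hφc n).const_mul _, fun m n => ?_,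
    fun g hg h => ?_, fun n x => ?_, hl, hanti, heven, fun n h => ?_⟩⟩
  · have h1 : ∫ t, v m t * v n t ∂muI = if m = n then 1 else 0 := by
      have := orthonormal_iff_ite.1 hv m n
      rw [L2.inner_def] at this
      rw [← this]
      refine integral_congr_ae (Filter.Eventually.of_forall fun t => ?_)
      simp [mul_comm]
    have h2 : ∫ t, e m * φ m t * (e n * φ n t) ∂muI = e m * e n * ∫ t, v m t * v n t ∂muI := by
      rw [← integral_const_mul]
      refine integral_congr_ae ?_
      filter_upwards [hφv m, hφv n] with t ht1 ht2
      rw [ht1, ht2]; ring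
    refine Eq.trans h2 ?_
    rw [h1]
    split_ifs with hmn
    · rw [hmn, he, one_mul]
    · simp
  · have hg' : MemLp g 2 muI := hg
    have h0 := hcomp (hg'.toLp g) fun n => by
      rw [L2.inner_def]
      have h1 : ∫ t, g t * (e n * φ n t) ∂muI = 0 := h n
      have h2 : ∫ t, g t * (e n * φ n t) ∂muI
          = e n * ∫ t, inner ℝ ((v n : Lp ℝ 2 muI) t) ((hg'.toLp g : Lp ℝ 2 muI) t) ∂muI := by
        rw [← integral_const_mul]
        refine integral_congr_ae ?_
        filter_upwards [hφv n, hg'.coeFn_toLp] with t ht1 ht2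
        rw [ht1, ht2]; simp; ring
      rw [h1] at h2
      exact (mul_eq_zero.1 h2.symm).resolve_left fun h => by
        have := he n
        rw [h] at this
        norm_num at this
    exact hg'.coeFn_toLp.symm.trans ((Lp.eq_zero_iff_ae_eq_zero).1 h0)
  · have h1 : sincOp c (fun x => e n * φ n x) x = e n * sincOp c (v n) x := by
      unfold sincOp
      rw [← integral_const_mul]
      refine integral_congr_ae ?_
      filter_upwards [(hφv n : φ n =ᵐ[volume.restrict (Icc (-1 : ℝ) 1)] v n)] with y hy
      rw [hy]; ring
    rw [h1]
    simp only [φ]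
    rw [mul_left_comm (l n), mul_inv_cancel_left₀ (hl n).ne']
  · rw [deriv_const_mul_field]
    exact hodd n h

/-- The prolate spheroidal wave functions with bandwidth `c`, together with the eigenvalues of
`𝒬_c` in decreasing order. -/
noncomputable def pswfSystem (c : ℝ) : (ℕ → ℝ → ℝ) × (ℕ → ℝ) :=
  Classical.epsilon fun p => IsPSWFSystem c p.1 p.2

/-- The prolate spheroidal wave function `ψ_{n,c}`. -/
noncomputable def pswf (c : ℝ) (n : ℕ) : ℝ → ℝ := (pswfSystem c).1 n

/-- The eigenvalue `λ_n(c)` of `𝒬_c`. -/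
noncomputable def pswfEigenvalue (c : ℝ) (n : ℕ) : ℝ := (pswfSystem c).2 n

theorem isPSWFSystem_pswf {c : ℝ} (hc : 0 < c) : IsPSWFSystem c (pswf c) (pswfEigenvalue c) := by
  obtain ⟨ψ, lam, h⟩ := exists_isPSWFSystem hc
  exact Classical.epsilon_spec (p := fun p : (ℕ → ℝ → ℝ) × (ℕ → ℝ) => IsPSWFSystem c p.1 p.2)
    ⟨(ψ, lam), h⟩

/-- The Fourier transform `\hat f (ω) = ∫ f (x) e^{-i ω x} dx` of `f ∈ L²(ℝ)`, in the sense of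
Plancherel (defined up to null sets). Mathlib's transform has the kernel `e^{-2 π i ξ x}`, whence
`ξ = ω / (2 π)`. -/
noncomputable def fourierL2 (f : ℝ → ℂ) (hf : MemLp f 2 volume) (ω : ℝ) : ℂ :=
  (𝓕 (hf.toLp f) : Lp ℂ 2 (volume : Measure ℝ)) (ω / (2 * Real.pi))

/-- `f` is normalized in `L²(ℝ)`, `εT`-concentrated in `T = [-a, a]` and `εΩ`-band concentrated in
`Ω = [-b, b]`. -/
structure IsConcentrated (a b εT εΩ : ℝ) (f : ℝ → ℂ) : Prop where
  memLp : MemLp f 2 volume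
  norm_eq_one : eLpNorm f 2 volume = 1
  time : ∫ t in (Icc (-a) a)ᶜ, ‖f t‖ ^ 2 ≤ εT ^ 2
  band : 1 / (2 * Real.pi) * ∫ ω in (Icc (-b) b)ᶜ, ‖fourierL2 f memLp ω‖ ^ 2 ≤ εΩ ^ 2

/-- The partial sum `S_{N,c} f = ∑_{n < N} a_n ψ_{n,c}` with `a_n = ∫_{-1}^{1} f ψ_{n,c}`. -/
noncomputable def partialSum (c : ℝ) (N : ℕ) (f : ℝ → ℂ) (t : ℝ) : ℂ :=
  ∑ n ∈ Finset.range N, (∫ s in Icc (-1 : ℝ) 1, f s * (pswf c n s : ℂ)) * (pswf c n t : ℂ)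

/-- The rescaled functions `a^{-1/2} ψ_{n,c}(t / a)`, an orthonormal basis of `L²([-a, a])`. -/
noncomputable def scaledPswf (c a : ℝ) (n : ℕ) (t : ℝ) : ℝ := 1 / √a * pswf c n (t / a)

/-- The `N`-th partial sum `S_{N,c,a} f` of the expansion of `f` in the rescaled basis. -/
noncomputable def scaledPartialSum (c a : ℝ) (N : ℕ) (f : ℝ → ℂ) (t : ℝ) : ℂ :=
  ∑ n ∈ Finset.range N,
    (∫ s in Icc (-a) a, f s * (scaledPswf c a n s : ℂ)) * (scaledPswf c a n t : ℂ)

/-- The time-limiting operator `P_T`, `T = [-a, a]`. -/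
noncomputable def timeLimit (a : ℝ) (f : ℝ → ℂ) : ℝ → ℂ := (Icc (-a) a).indicator f

end PSWF

/-!
Let `T = [-a, a]`, let `S f` be the partial sum of order `N`, and put `u = χ_T (f - S f)`. The
function `u` is supported in `T` and orthogonal to the first `N` basis functions, hence to `S f`, so
that Plancherel's theorem gives
`‖u‖² = ⟪u, f⟫ = ⟪û, f̂⟫`.
Split the last inner product over the band `Ω` and its complement. By Cauchy-Schwarz the outer part
is at most `‖u‖ εΩ`, and the inner part is at most `(∫_Ω |û|²)^{1/2}` since `‖f̂‖ = 1`. The energy of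
`û` in the band is, after rescaling to `[-1, 1]`, the quadratic form of the sinc kernel operator,
which on the orthogonal complement of the first `N` eigenfunctions is bounded by
`λ_N`. Thus `‖u‖² ≤ (εΩ + √λ_N) ‖u‖`, which is the estimate on `T`; the estimate on the line
adds the energy `εT` of `f` outside `T`.

The spectral bound is `IsPSWFSystem.inner_sincLp_le`, its reading as a bound for Fourier transforms
is `setIntegral_fourier_le`, and the duality argument is
`IsConcentrated.eLpNorm_sub_scaledPartialSum_le`. The unscaled expansion is the case `a = 1`.
-/

namespace PSWF

open MeasureTheory Set
open scoped RealInnerProductSpace FourierTransform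

/-! ### The Fourier transform and the norm of `L²` -/

/-- On `L¹ ∩ L²` the Plancherel transform is given by the Fourier integral: the two agree as tempered
distributions. -/
theorem fourier_toLp_ae_eq {u : ℝ → ℂ} (hu1 : Integrable u) (hu2 : MemLp u 2 volume) :
    (𝓕 (hu2.toLp u) : Lp ℂ 2 (volume : Measure ℝ)) =ᵐ[volume] 𝓕 u := by
  have hcont : Continuous (𝓕 u : ℝ → ℂ) :=
    VectorFourier.fourierIntegral_continuous Real.continuous_fourierChar
      (by exact continuous_inner) hu1
  refine ae_eq_of_integral_contDiff_smul_eq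
    ((Lp.memLp _).locallyIntegrable (by norm_num)) hcont.locallyIntegrable fun g hg hgc => ?_
  -- Testing against a Schwartz function moves both transforms onto the test function.
  let φ : SchwartzMap ℝ ℂ := (hgc.comp_left (g := ((↑) : ℝ → ℂ)) (by simp)).toSchwartzMap
    (Complex.ofRealCLM.contDiff.comp hg)
  have hφ : ∀ x, φ x = (g x : ℂ) := fun x => rfl
  have h1 := congrArg (fun T => T φ) (Lp.fourier_toTemperedDistribution_eq (hu2.toLp u))
  simp only [TemperedDistribution.fourier_apply, Lp.toTemperedDistribution_apply] at h1
  have h2 : ∫ x, (𝓕 φ) x • u x = ∫ x, φ x • 𝓕 u x := by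
    have := VectorFourier.integral_fourierIntegral_smul_eq_flip (L := innerₗ ℝ) (μ := volume)
      (ν := volume) (f := φ) (g := u) Real.continuous_fourierChar continuous_inner
      φ.integrable hu1
    rw [flip_innerₗ] at this
    rw [SchwartzMap.fourier_coe]
    exact this
  have h3 : ∫ x, (𝓕 φ) x • u x = ∫ x, (𝓕 φ) x • (hu2.toLp u : Lp ℂ 2 volume) x := by
    refine integral_congr_ae ?_
    filter_upwards [hu2.coeFn_toLp] with x hx
    rw [hx]
  simp_rw [← Complex.coe_smul, ← hφ]
  rw [← h1, ← h3, h2]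

theorem norm_toLp_sq {α : Type*} {m : MeasurableSpace α} {μ : Measure α} {f : α → ℂ}
    (hf : MemLp f 2 μ) : ‖hf.toLp f‖ ^ 2 = ∫ t, ‖f t‖ ^ 2 ∂μ := by
  rw [@norm_sq_eq_re_inner ℂ, L2.inner_def]
  have : ∫ t, inner ℂ ((hf.toLp f : Lp ℂ 2 μ) t) ((hf.toLp f : Lp ℂ 2 μ) t) ∂μ
      = ∫ t, ((‖f t‖ ^ 2 : ℝ) : ℂ) ∂μ := by
    refine integral_congr_ae ?_
    filter_upwards [hf.coeFn_toLp] with t ht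
    rw [ht, inner_self_eq_norm_sq_to_K]
    simp
  rw [this, integral_complex_ofReal]
  simp

theorem eLpNorm_two_eq {α : Type*} {m : MeasurableSpace α} {μ : Measure α} {f : α → ℂ}
    (hf : MemLp f 2 μ) : eLpNorm f 2 μ = ENNReal.ofReal √(∫ t, ‖f t‖ ^ 2 ∂μ) := by
  rw [← norm_toLp_sq hf, Real.sqrt_sq (norm_nonneg _), Lp.norm_toLp,
    ENNReal.ofReal_toReal hf.eLpNorm_ne_top]

/-! ### The spectral bound for the sinc kernel operator -/

section System

variable {c : ℝ} {ψ : ℕ → ℝ → ℝ} {lam : ℕ → ℝ}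

theorem IsPSWFSystem.sincLp_eigen (h : IsPSWFSystem c ψ lam) (hc : 0 < c) (n : ℕ) :
    sincLp c (contLp (ψ n) (h.continuous n)) = lam n • contLp (ψ n) (h.continuous n) := by
  apply Lp.ext
  filter_upwards [sincLp_ae hc (contLp (ψ n) (h.continuous n)),
    Lp.coeFn_smul (lam n) (contLp (ψ n) (h.continuous n)), contLp_ae (ψ n) (h.continuous n)]
    with x h1 h2 h3
  rw [h1, h2, Pi.smul_apply, h3, smul_eq_mul, ← h.eigen n x]
  unfold sincOp
  refine integral_congr_ae ?_
  filter_upwards [(contLp_ae (ψ n) (h.continuous n) :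
    contLp (ψ n) (h.continuous n) =ᵐ[volume.restrict (Icc (-1 : ℝ) 1)] ψ n)] with y hy
  rw [hy]

theorem IsPSWFSystem.orthonormal_contLp (h : IsPSWFSystem c ψ lam) :
    Orthonormal ℝ fun n => contLp (ψ n) (h.continuous n) := by
  rw [orthonormal_iff_ite]
  intro m n
  rw [inner_contLp, ← h.orthonormal m n]
  refine integral_congr_ae ?_
  filter_upwards [contLp_ae (ψ n) (h.continuous n)] with t ht
  rw [ht]

/-- The prolate spheroidal wave functions as a Hilbert basis of the real space `L²(-1, 1)`. -/
noncomputable def IsPSWFSystem.hilbertBasis (h : IsPSWFSystem c ψ lam) :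
    HilbertBasis ℕ ℝ (Lp ℝ 2 muI) :=
  HilbertBasis.mkOfOrthogonalEqBot h.orthonormal_contLp <| by
    rw [Submodule.eq_bot_iff]
    intro g hg
    rw [Lp.eq_zero_iff_ae_eq_zero]
    refine h.complete g (Lp.memLp g) fun n => ?_
    have := hg _ (Submodule.subset_span (mem_range_self n))
    rw [inner_contLp] at this
    simp_rw [mul_comm (g _)]
    exact this

theorem IsPSWFSystem.hilbertBasis_apply (h : IsPSWFSystem c ψ lam) (n : ℕ) :
    h.hilbertBasis n = contLp (ψ n) (h.continuous n) := by
  simp [IsPSWFSystem.hilbertBasis]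

/-- On the orthogonal complement of the first `N` eigenfunctions, the quadratic form of the sinc
kernel operator is at most `lam N`: compare the expansions of both sides in the eigenbasis. -/
theorem IsPSWFSystem.inner_sincLp_le (h : IsPSWFSystem c ψ lam) (hc : 0 < c) (N : ℕ)
    (g : Lp ℝ 2 muI) (hg : ∀ n < N, ∫ t, ψ n t * g t ∂muI = 0) :
    ⟪sincLp c g, g⟫ ≤ lam N * ⟪g, g⟫ := by
  refine hasSum_le (fun n => ?_) (h.hilbertBasis.hasSum_inner_mul_inner (sincLp c g) g)
    ((h.hilbertBasis.hasSum_inner_mul_inner g g).mul_left (lam N))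
  have h1 : ⟪sincLp c g, h.hilbertBasis n⟫ = lam n * ⟪g, h.hilbertBasis n⟫ := by
    rw [show ⟪sincLp c g, h.hilbertBasis n⟫ = ⟪g, sincLp c (h.hilbertBasis n)⟫ from
      sincLp_symm c g _, h.hilbertBasis_apply, h.sincLp_eigen hc, real_inner_smul_right]
  rw [h1, mul_assoc, real_inner_comm (h.hilbertBasis n) g]
  rcases lt_or_ge n N with hn | hn
  · rw [h.hilbertBasis_apply, inner_contLp, hg n hn]
    simp
  · exact mul_le_mul_of_nonneg_right (h.antitone hn) (mul_self_nonneg _)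

/-- The spectral bound with the quadratic form written as the energy of the cosine and sine
transforms in the band. -/
theorem IsPSWFSystem.integral_trig_le (h : IsPSWFSystem c ψ lam) (hc : 0 < c) (N : ℕ)
    {g : ℝ → ℝ} (hg2 : MemLp g 2 muI) (hg : ∀ n < N, ∫ t, ψ n t * g t ∂muI = 0) :
    ∫ w in (0 : ℝ)..c, ((∫ t, Real.cos (w * t) * g t ∂muI) ^ 2 +
        (∫ t, Real.sin (w * t) * g t ∂muI) ^ 2)
      ≤ Real.pi * lam N * ∫ t, g t ^ 2 ∂muI := by
  have hae := hg2.coeFn_toLp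
  have hI : ∀ k : ℝ → ℝ, ∫ t, k t * hg2.toLp g t ∂muI = ∫ t, k t * g t ∂muI := fun k =>
    integral_congr_ae (by filter_upwards [hae] with t ht; rw [ht])
  have h1 := h.inner_sincLp_le hc N (hg2.toLp g) fun n hn => by rw [hI]; exact hg n hn
  have h2 : ⟪hg2.toLp g, hg2.toLp g⟫ = ∫ t, g t ^ 2 ∂muI := by
    rw [L2.inner_def]
    refine integral_congr_ae ?_
    filter_upwards [hae] with t ht
    rw [ht]; simp [pow_two]
  rw [sincLp_inner, intervalIntegral.integral_const_mul, h2] at h1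
  simp_rw [cosLp, sinLp, inner_contLp, hI, ← pow_two] at h1
  rw [inv_mul_le_iff₀ Real.pi_pos] at h1
  linarith

end System

/-- The spectral bound for complex functions on `[-1, 1]`, whose transform need not have an even
modulus: on adding the values at `w` and `-w`, the interaction of the real and imaginary parts
cancels. -/
theorem IsPSWFSystem.integral_norm_sq_exp_le {c : ℝ} {ψ : ℕ → ℝ → ℝ} {lam : ℕ → ℝ}
    (h : IsPSWFSystem c ψ lam) (hc : 0 < c) (N : ℕ) {v : ℝ → ℂ} (hv2 : MemLp v 2 muI)
    (hv : ∀ n < N, ∫ t, v t * (ψ n t : ℂ) ∂muI = 0) :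
    ∫ w in (-c)..c, ‖∫ s, Complex.exp ((-(w * s) : ℝ) * Complex.I) * v s ∂muI‖ ^ 2
      ≤ 2 * Real.pi * lam N * ∫ t, ‖v t‖ ^ 2 ∂muI := by
  have hre : MemLp (fun t => (v t).re) 2 muI := hv2.re
  have him : MemLp (fun t => (v t).im) 2 muI := hv2.im
  have hvi : ∀ n, Integrable (fun t => v t * (ψ n t : ℂ)) muI := fun n =>
    hv2.integrable_mul (memLp_muI (h.continuous n)).ofReal
  have hre0 : ∀ n < N, ∫ t, ψ n t * (v t).re ∂muI = 0 := fun n hn => by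
    have h1 := (integral_re (𝕜 := ℂ) (hvi n)).trans (congrArg Complex.re (hv n hn))
    simp at h1
    simpa [mul_comm] using h1
  have him0 : ∀ n < N, ∫ t, ψ n t * (v t).im ∂muI = 0 := fun n hn => by
    have h1 := (integral_im (𝕜 := ℂ) (hvi n)).trans (congrArg Complex.im (hv n hn))
    simp at h1
    simpa [mul_comm] using h1
  have hcos : ∀ {g : ℝ → ℝ}, MemLp g 2 muI →
      Continuous fun w => ∫ t, Real.cos (w * t) * g t ∂muI := by
    intro g hg
    have h1 : Continuous fun w => ⟪cosLp w, hg.toLp g⟫ := continuous_cosLp.inner continuous_const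
    refine h1.congr fun w => ?_
    rw [cosLp, inner_contLp]
    exact integral_congr_ae (by filter_upwards [hg.coeFn_toLp] with t ht; rw [ht])
  have hsin : ∀ {g : ℝ → ℝ}, MemLp g 2 muI →
      Continuous fun w => ∫ t, Real.sin (w * t) * g t ∂muI := by
    intro g hg
    have h1 : Continuous fun w => ⟪sinLp w, hg.toLp g⟫ := continuous_sinLp.inner continuous_const
    refine h1.congr fun w => ?_
    rw [sinLp, inner_contLp]
    exact integral_congr_ae (by filter_upwards [hg.coeFn_toLp] with t ht; rw [ht])
  have icos : ∀ {g : ℝ → ℝ}, MemLp g 2 muI → ∀ w,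
      Integrable (fun t => Real.cos (w * t) * g t) muI := fun hg w =>
    (memLp_muI (cos_cont w)).integrable_mul hg
  have isin : ∀ {g : ℝ → ℝ}, MemLp g 2 muI → ∀ w,
      Integrable (fun t => Real.sin (w * t) * g t) muI := fun hg w =>
    (memLp_muI (sin_cont w)).integrable_mul hg
  set A : ℝ → ℝ := fun w => ∫ t, Real.cos (w * t) * (v t).re ∂muI with hA
  set B : ℝ → ℝ := fun w => ∫ t, Real.sin (w * t) * (v t).re ∂muI with hB
  set C : ℝ → ℝ := fun w => ∫ t, Real.cos (w * t) * (v t).im ∂muI with hC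
  set D : ℝ → ℝ := fun w => ∫ t, Real.sin (w * t) * (v t).im ∂muI with hD
  have cA : Continuous A := hcos hre
  have cB : Continuous B := hsin hre
  have cC : Continuous C := hcos him
  have cD : Continuous D := hsin him
  have hV : ∀ w : ℝ, ‖∫ s, Complex.exp ((-(w * s) : ℝ) * Complex.I) * v s ∂muI‖ ^ 2
      = (A w + D w) ^ 2 + (C w - B w) ^ 2 := by
    intro w
    have : ∀ s : ℝ, Complex.exp ((-(w * s) : ℝ) * Complex.I) * v s
        = ((Real.cos (w * s) * (v s).re + Real.sin (w * s) * (v s).im : ℝ) : ℂ) +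
          ((Real.cos (w * s) * (v s).im - Real.sin (w * s) * (v s).re : ℝ) : ℂ) * Complex.I := by
      intro s
      rw [Complex.exp_ofReal_mul_I]
      apply Complex.ext <;> simp <;> ring
    simp_rw [this]
    rw [integral_add ((icos hre w).add (isin him w)).ofReal
      (((icos him w).sub (isin hre w)).ofReal.mul_const _), integral_mul_const,
      integral_complex_ofReal, integral_complex_ofReal, integral_add (icos hre w) (isin him w),
      integral_sub (icos him w) (isin hre w), ← Complex.normSq_eq_norm_sq,
      Complex.normSq_add_mul_I]
  have hneg : ∀ w, A (-w) = A w ∧ B (-w) = -B w ∧ C (-w) = C w ∧ D (-w) = -D w := by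
    intro w
    refine ⟨?_, ?_, ?_, ?_⟩ <;> simp [hA, hB, hC, hD, integral_neg]
  simp_rw [hV]
  have hint : ∀ p q : ℝ, IntervalIntegrable (fun w => (A w + D w) ^ 2 + (C w - B w) ^ 2)
      volume p q := fun p q => Continuous.intervalIntegrable (by fun_prop) p q
  have h0 : ∫ w in (-c)..0, ((A w + D w) ^ 2 + (C w - B w) ^ 2)
      = ∫ w in (0 : ℝ)..c, ((A w - D w) ^ 2 + (C w + B w) ^ 2) := by
    have := intervalIntegral.integral_comp_neg (a := 0) (b := c)
      fun w => (A w + D w) ^ 2 + (C w - B w) ^ 2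
    rw [neg_zero] at this
    rw [← this]
    refine intervalIntegral.integral_congr fun w _ => ?_
    obtain ⟨h1, h2, h3, h4⟩ := hneg w
    simp only [h1, h2, h3, h4]; ring
  rw [← intervalIntegral.integral_add_adjacent_intervals (hint (-c) 0) (hint 0 c), h0,
    ← intervalIntegral.integral_add (Continuous.intervalIntegrable (by fun_prop) _ _)
      (hint 0 c)]
  have h1 : ∫ w in (0 : ℝ)..c, ((A w - D w) ^ 2 + (C w + B w) ^ 2 +
        ((A w + D w) ^ 2 + (C w - B w) ^ 2))
      = 2 * ((∫ w in (0 : ℝ)..c, (A w ^ 2 + B w ^ 2)) + ∫ w in (0 : ℝ)..c, (C w ^ 2 + D w ^ 2)) := by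
    rw [← intervalIntegral.integral_add (Continuous.intervalIntegrable (by fun_prop) _ _)
      (Continuous.intervalIntegrable (by fun_prop) _ _), ← intervalIntegral.integral_const_mul]
    refine intervalIntegral.integral_congr fun w _ => ?_
    ring
  have h2 : ∫ t, ‖v t‖ ^ 2 ∂muI = (∫ t, (v t).re ^ 2 ∂muI) + ∫ t, (v t).im ^ 2 ∂muI := by
    rw [← integral_add hre.integrable_sq him.integrable_sq]
    refine integral_congr_ae (Filter.Eventually.of_forall fun t => ?_)
    beta_reduce
    rw [← Complex.normSq_eq_norm_sq, Complex.normSq_apply]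
    ring
  rw [h1, h2]
  linarith [h.integral_trig_le hc N hre hre0, h.integral_trig_le hc N him him0]

/-! ### Splitting an inner product, and rescaling -/

/-- The Cauchy-Schwarz inequality applied separately on `B` and on its complement. -/
theorem norm_inner_le_setIntegral {B : Set ℝ} (hB : MeasurableSet B)
    (X Y : Lp ℂ 2 (volume : Measure ℝ)) :
    ‖inner ℂ X Y‖ ≤ √(∫ t in B, ‖X t‖ ^ 2) * ‖Y‖ + ‖X‖ * √(∫ t in Bᶜ, ‖Y t‖ ^ 2) := by
  have hp : MemLp (B.indicator X) 2 volume := (Lp.memLp X).indicator hB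
  have hq : MemLp (Bᶜ.indicator Y) 2 volume := (Lp.memLp Y).indicator hB.compl
  have hn : ∀ {A : Set ℝ} (hA : MeasurableSet A) (Z : Lp ℂ 2 (volume : Measure ℝ))
      (hz : MemLp (A.indicator Z) 2 volume), ‖hz.toLp _‖ = √(∫ t in A, ‖Z t‖ ^ 2) := by
    intro A hA Z hz
    rw [← Real.sqrt_sq (norm_nonneg (hz.toLp _)), norm_toLp_sq, ← integral_indicator hA]
    congr 2 with t
    by_cases ht : t ∈ A <;> simp [ht]
  have hsplit : inner ℂ X Y = inner ℂ (hp.toLp _) Y + inner ℂ X (hq.toLp _) := by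
    rw [L2.inner_def, L2.inner_def, L2.inner_def,
      ← integral_add (L2.integrable_inner _ _) (L2.integrable_inner _ _)]
    refine integral_congr_ae ?_
    filter_upwards [hp.coeFn_toLp, hq.coeFn_toLp] with t h1 h2
    rw [h1, h2]
    by_cases ht : t ∈ B <;> simp [ht]
  rw [hsplit, ← hn hB X hp, ← hn hB.compl Y hq]
  exact (norm_add_le _ _).trans (add_le_add (norm_inner_le_norm _ _) (norm_inner_le_norm _ _))

theorem setIntegral_Icc_eq_comp_mul {a : ℝ} (ha : 0 < a) (F : ℝ → ℂ) :
    ∫ t in Icc (-a) a, F t = a * ∫ s, F (a * s) ∂muI := by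
  have h1 := intervalIntegral.integral_comp_mul_left (a := -1) (b := 1) F ha.ne'
  rw [muI, integral_Icc_eq_integral_Ioc, integral_Icc_eq_integral_Ioc,
    ← intervalIntegral.integral_of_le (by linarith), ← intervalIntegral.integral_of_le (by norm_num),
    h1, mul_neg, mul_one, Complex.real_smul, ← mul_assoc, ← Complex.ofReal_mul,
    mul_inv_cancel₀ ha.ne', Complex.ofReal_one, one_mul]

theorem memLp_comp_mul_left {a : ℝ} (ha : a ≠ 0) {u : ℝ → ℂ} (hu : MemLp u 2 volume) :
    MemLp (fun s => u (a * s)) 2 volume := by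
  refine MemLp.comp_of_map ?_ (by fun_prop)
  rw [Real.map_volume_mul_left ha]
  exact hu.smul_measure ENNReal.ofReal_ne_top

/-- The energy in the band `[-b, b]` of a function supported in `[-a, a]` and orthogonal to the first
`N` rescaled basis functions. The transform has the kernel `e^{-2πiξt}`, so that the band is
`|ξ| ≤ b / (2π)`. -/
theorem setIntegral_fourier_le {a b : ℝ} (ha : 0 < a) (hb : 0 < b) (N : ℕ) {u : ℝ → ℂ}
    (hu2 : MemLp u 2 volume) (hu0 : ∀ t ∉ Icc (-a) a, u t = 0)
    (hu : ∀ n < N, ∫ t in Icc (-a) a, u t * (scaledPswf (a * b) a n t : ℂ) = 0) :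
    ∫ ξ in Icc (-(b / (2 * Real.pi))) (b / (2 * Real.pi)), ‖𝓕 u ξ‖ ^ 2
      ≤ pswfEigenvalue (a * b) N * ∫ t, ‖u t‖ ^ 2 := by
  have hpi := Real.pi_pos
  have hsys := isPSWFSystem_pswf (mul_pos ha hb)
  have hv2 : MemLp (fun s => u (a * s)) 2 muI := (memLp_comp_mul_left ha.ne' hu2).restrict _
  have hv : ∀ n < N, ∫ t, u (a * t) * (pswf (a * b) n t : ℂ) ∂muI = 0 := by
    intro n hn
    have h1 := hu n hn
    rw [setIntegral_Icc_eq_comp_mul ha] at h1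
    simp only [scaledPswf, mul_div_cancel_left₀ _ ha.ne', Complex.ofReal_mul,
      mul_left_comm (u _)] at h1
    rw [integral_const_mul] at h1
    have h2 : ((1 / √a : ℝ) : ℂ) ≠ 0 := by
      rw [Complex.ofReal_ne_zero]; positivity
    have h3 := (mul_eq_zero.1 h1).resolve_left (Complex.ofReal_ne_zero.2 ha.ne')
    exact (mul_eq_zero.1 h3).resolve_left h2
  have key := hsys.integral_norm_sq_exp_le (mul_pos ha hb) N hv2 hv
  have hF : ∀ ξ : ℝ, 𝓕 u ξ = a * ∫ s, Complex.exp ((-((2 * Real.pi * a * ξ) * s) : ℝ) * Complex.I) *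
      u (a * s) ∂muI := by
    intro ξ
    rw [Real.fourier_real_eq_integral_exp_smul, ← setIntegral_eq_integral_of_forall_compl_eq_zero
      (s := Icc (-a) a) (fun t ht => by rw [hu0 t ht, smul_zero]), setIntegral_Icc_eq_comp_mul ha]
    congr 2 with s
    rw [smul_eq_mul]
    congr 4
    ring
  have hnorm : ∫ t, ‖u t‖ ^ 2 = a * ∫ s, ‖u (a * s)‖ ^ 2 ∂muI := by
    have h1 := setIntegral_Icc_eq_comp_mul ha fun t => ((‖u t‖ ^ 2 : ℝ) : ℂ)
    rw [integral_complex_ofReal, integral_complex_ofReal, ← Complex.ofReal_mul,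
      Complex.ofReal_inj, setIntegral_eq_integral_of_forall_compl_eq_zero
      (fun t ht => by rw [hu0 t ht]; simp)] at h1
    exact h1
  -- The frequency `w = 2πaξ` of the rescaled function sweeps `[-ab, ab]`.
  have hsub := intervalIntegral.integral_comp_mul_left (a := -(b / (2 * Real.pi)))
    (b := b / (2 * Real.pi)) (c := 2 * Real.pi * a)
    (fun w : ℝ => ‖∫ s, Complex.exp ((-(w * s) : ℝ) * Complex.I) * u (a * s) ∂muI‖ ^ 2)
    (by positivity)
  have hc : 2 * Real.pi * a * (b / (2 * Real.pi)) = a * b := by field_simp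
  rw [mul_neg, hc] at hsub
  simp_rw [hF, norm_mul, mul_pow, Complex.norm_real, Real.norm_of_nonneg ha.le]
  rw [integral_const_mul, integral_Icc_eq_integral_Ioc,
    ← intervalIntegral.integral_of_le (by linarith [show 0 < b / (2 * Real.pi) by positivity]),
    hsub, hnorm, smul_eq_mul]
  calc a ^ 2 * ((2 * Real.pi * a)⁻¹ * _)
      ≤ a ^ 2 * ((2 * Real.pi * a)⁻¹ * (2 * Real.pi * pswfEigenvalue (a * b) N *
          ∫ s, ‖u (a * s)‖ ^ 2 ∂muI)) := by gcongr
    _ = _ := by field_simp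

/-! ### The rescaled basis and its partial sums -/

theorem continuous_scaledPswf {a b : ℝ} (ha : 0 < a) (hb : 0 < b) (n : ℕ) :
    Continuous (scaledPswf (a * b) a n) := by
  have := (isPSWFSystem_pswf (mul_pos ha hb)).continuous n
  unfold scaledPswf
  fun_prop

theorem memLp_scaledPswf {a b : ℝ} (ha : 0 < a) (hb : 0 < b) (n : ℕ) :
    MemLp (fun t => (scaledPswf (a * b) a n t : ℂ)) 2 (volume.restrict (Icc (-a) a)) := by
  have hf := Complex.continuous_ofReal.comp (continuous_scaledPswf ha hb n)
  obtain ⟨C, hC⟩ := isCompact_Icc.exists_bound_of_continuousOn (hf.continuousOn (s := Icc (-a) a))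
  refine MemLp.of_bound hf.aestronglyMeasurable C ?_
  filter_upwards [ae_restrict_mem measurableSet_Icc] with x hx using hC x hx

theorem integral_scaledPswf_mul {a b : ℝ} (ha : 0 < a) (hb : 0 < b) (m n : ℕ) :
    ∫ t in Icc (-a) a, (scaledPswf (a * b) a m t : ℂ) * (scaledPswf (a * b) a n t : ℂ)
      = if m = n then 1 else 0 := by
  have ho : ∫ t, pswf (a * b) m t * pswf (a * b) n t ∂muI = if m = n then 1 else 0 :=
    (isPSWFSystem_pswf (mul_pos ha hb)).orthonormal m n
  have hsq : 1 / √a * (1 / √a) = a⁻¹ := by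
    rw [← mul_inv_cancel_left₀ ha.ne' (1 / √a * (1 / √a))]
    field_simp
    exact (Real.sq_sqrt ha.le).symm
  rw [setIntegral_Icc_eq_comp_mul ha]
  have : ∀ s : ℝ, (scaledPswf (a * b) a m (a * s) : ℂ) * (scaledPswf (a * b) a n (a * s) : ℂ)
      = ((a⁻¹ * (pswf (a * b) m s * pswf (a * b) n s) : ℝ) : ℂ) := by
    intro s
    rw [← hsq, scaledPswf, scaledPswf, mul_div_cancel_left₀ _ ha.ne']
    push_cast; ring
  simp_rw [this]
  rw [integral_complex_ofReal, integral_const_mul, ho, ← Complex.ofReal_mul,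
    mul_inv_cancel_left₀ ha.ne']
  split_ifs <;> simp

theorem integral_mul_scaledPartialSum {a b : ℝ} (ha : 0 < a) (hb : 0 < b) (N : ℕ)
    (f : ℝ → ℂ) {u : ℝ → ℂ} (hu : MemLp u 2 (volume.restrict (Icc (-a) a))) :
    ∫ t in Icc (-a) a, u t * scaledPartialSum (a * b) a N f t
      = ∑ n ∈ Finset.range N, (∫ s in Icc (-a) a, f s * (scaledPswf (a * b) a n s : ℂ)) *
          ∫ t in Icc (-a) a, u t * (scaledPswf (a * b) a n t : ℂ) := by
  simp_rw [scaledPartialSum, Finset.mul_sum, mul_left_comm (u _)]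
  have hi : ∀ n, Integrable (fun t => u t * (scaledPswf (a * b) a n t : ℂ))
      (volume.restrict (Icc (-a) a)) := fun n => hu.integrable_mul (memLp_scaledPswf ha hb n)
  rw [integral_finsetSum _ fun n _ => (hi n).const_mul _]
  simp_rw [integral_const_mul]

theorem memLp_scaledPartialSum {a b : ℝ} (ha : 0 < a) (hb : 0 < b) (N : ℕ) (f : ℝ → ℂ) :
    MemLp (scaledPartialSum (a * b) a N f) 2 (volume.restrict (Icc (-a) a)) :=
  memLp_finsetSum _ fun n _ => (memLp_scaledPswf ha hb n).const_mul _

/-- The remainder `f - S f` is orthogonal to the first `N` basis functions. -/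
theorem integral_sub_scaledPartialSum_mul {a b : ℝ} (ha : 0 < a) (hb : 0 < b) {N n : ℕ}
    (hn : n < N) {f : ℝ → ℂ} (hf : MemLp f 2 (volume.restrict (Icc (-a) a))) :
    ∫ t in Icc (-a) a, (f t - scaledPartialSum (a * b) a N f t) *
      (scaledPswf (a * b) a n t : ℂ) = 0 := by
  have hφ := memLp_scaledPswf ha hb n
  have h1 : Integrable (fun t => f t * (scaledPswf (a * b) a n t : ℂ))
      (volume.restrict (Icc (-a) a)) := hf.integrable_mul hφ
  have h2 : Integrable (fun t => scaledPartialSum (a * b) a N f t *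
      (scaledPswf (a * b) a n t : ℂ)) (volume.restrict (Icc (-a) a)) :=
    (memLp_scaledPartialSum ha hb N f).integrable_mul hφ
  simp_rw [sub_mul]
  rw [integral_sub h1 h2]
  simp_rw [mul_comm (scaledPartialSum _ _ _ _ _)]
  rw [integral_mul_scaledPartialSum ha hb N f hφ]
  simp_rw [integral_scaledPswf_mul ha hb]
  simp [hn]

/-! ### Approximation of concentrated functions -/

/-- Band concentration in the frequency variable `ξ = ω / (2π)`; the substitution absorbs the factor
`1 / (2π)`. -/
theorem IsConcentrated.integral_fourier_le {a b εT εΩ : ℝ} {f : ℝ → ℂ}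
    (hf : IsConcentrated a b εT εΩ f) :
    ∫ ξ in (Icc (-(b / (2 * Real.pi))) (b / (2 * Real.pi)))ᶜ,
      ‖(𝓕 (hf.memLp.toLp f) : Lp ℂ 2 (volume : Measure ℝ)) ξ‖ ^ 2 ≤ εΩ ^ 2 := by
  have hpi := Real.pi_pos
  refine le_of_eq_of_le ?_ hf.band
  set G : ℝ → ℝ := (Icc (-(b / (2 * Real.pi))) (b / (2 * Real.pi)))ᶜ.indicator fun ξ =>
    ‖(𝓕 (hf.memLp.toLp f) : Lp ℂ 2 (volume : Measure ℝ)) ξ‖ ^ 2 with hG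
  have h1 := Measure.integral_comp_mul_left G (2 * Real.pi)⁻¹
  rw [inv_inv, abs_of_pos (by positivity), smul_eq_mul] at h1
  rw [← integral_indicator measurableSet_Icc.compl, ← integral_indicator measurableSet_Icc.compl,
    ← hG, show ∫ ξ, G ξ = 1 / (2 * Real.pi) * ∫ ω, G ((2 * Real.pi)⁻¹ * ω) by rw [h1]; field_simp]
  congr 2 with ω
  have hiff : (2 * Real.pi)⁻¹ * ω ∈ (Icc (-(b / (2 * Real.pi))) (b / (2 * Real.pi)))ᶜ ↔
      ω ∈ (Icc (-b) b)ᶜ := by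
    rw [mem_compl_iff, mem_compl_iff, not_iff_not, mem_Icc, mem_Icc, inv_mul_eq_div, ← neg_div,
      div_le_div_iff_of_pos_right (by positivity), div_le_div_iff_of_pos_right (by positivity)]
  by_cases hω : ω ∈ (Icc (-b) b)ᶜ
  · rw [hG, indicator_of_mem (hiff.2 hω), indicator_of_mem hω, inv_mul_eq_div]
    rfl
  · rw [hG, indicator_of_notMem (mt hiff.1 hω), indicator_of_notMem hω]

/-- The estimate on `[-a, a]`, by duality: the remainder is paired with `f` on the Fourier side. -/
theorem IsConcentrated.eLpNorm_sub_scaledPartialSum_le {a b εT εΩ : ℝ} {f : ℝ → ℂ} (ha : 0 < a)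
    (hb : 0 < b) (hΩ : 0 ≤ εΩ) (hf : IsConcentrated a b εT εΩ f) (N : ℕ) :
    eLpNorm (fun t => f t - scaledPartialSum (a * b) a N f t) 2 (volume.restrict (Icc (-a) a))
      ≤ ENNReal.ofReal (εΩ + √(pswfEigenvalue (a * b) N)) := by
  set T := Icc (-a) a with hT
  set S := scaledPartialSum (a * b) a N f
  have hfT : MemLp f 2 (volume.restrict T) := hf.memLp.restrict _
  have hr : MemLp (fun t => f t - S t) 2 (volume.restrict T) :=
    hfT.sub (memLp_scaledPartialSum ha hb N f)
  set u : ℝ → ℂ := T.indicator fun t => f t - S t with hu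
  have hu2 : MemLp u 2 volume := (memLp_indicator_iff_restrict measurableSet_Icc).2 hr
  have hu1 : Integrable u volume :=
    (integrable_indicator_iff measurableSet_Icc).2 (hr.integrable (by norm_num))
  have huT : ∀ t ∈ T, u t = f t - S t := fun t ht => indicator_of_mem ht _
  have hu0 : ∀ t ∉ T, u t = 0 := fun t ht => indicator_of_notMem ht _
  have horth : ∀ n < N, ∫ t in T, u t * (scaledPswf (a * b) a n t : ℂ) = 0 := by
    intro n hn
    rw [← integral_sub_scaledPartialSum_mul ha hb hn hfT]
    exact setIntegral_congr_fun measurableSet_Icc fun t ht => by rw [huT t ht]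
  set U := hu2.toLp u
  set F := hf.memLp.toLp f with hF
  have hFn : ‖F‖ = 1 := by rw [hF, Lp.norm_toLp, hf.norm_eq_one, ENNReal.toReal_one]
  -- `U` is orthogonal to the partial sum, which is the part of `F - U` on `T`.
  have hUF : inner ℂ F U = inner ℂ U U := by
    have hS : ∫ t in T, (starRingEnd ℂ) (u t) * S t = 0 := by
      have hc : MemLp (fun t => (starRingEnd ℂ) (u t)) 2 (volume.restrict T) :=
        (hu2.restrict _).star
      rw [integral_mul_scaledPartialSum ha hb N f hc]
      refine Finset.sum_eq_zero fun n hn => ?_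
      have h1 := congrArg (starRingEnd ℂ) (horth n (Finset.mem_range.1 hn))
      rw [← integral_conj, map_zero] at h1
      simp only [map_mul, Complex.conj_ofReal] at h1
      rw [h1, mul_zero]
    have hd : inner ℂ U F - inner ℂ U U = 0 := by
      rw [L2.inner_def, L2.inner_def,
        ← integral_sub (L2.integrable_inner _ _) (L2.integrable_inner _ _), ← hS,
        ← integral_indicator measurableSet_Icc]
      refine integral_congr_ae ?_
      filter_upwards [hu2.coeFn_toLp, hf.memLp.coeFn_toLp] with t h1 h2
      rw [h1, h2]
      by_cases ht : t ∈ T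
      · rw [indicator_of_mem ht]
        simp only [RCLike.inner_apply, huT t ht]
        ring
      · rw [indicator_of_notMem ht]
        simp [hu0 t ht]
    rw [← inner_conj_symm, sub_eq_zero.1 hd, inner_conj_symm]
  have hlam : 0 ≤ pswfEigenvalue (a * b) N := ((isPSWFSystem_pswf (mul_pos ha hb)).pos N).le
  have hEU : ∫ ξ in Icc (-(b / (2 * Real.pi))) (b / (2 * Real.pi)), ‖(𝓕 U) ξ‖ ^ 2
      ≤ pswfEigenvalue (a * b) N * ‖U‖ ^ 2 := by
    rw [norm_toLp_sq]
    refine le_of_eq_of_le ?_ (setIntegral_fourier_le ha hb N hu2 hu0 horth)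
    refine integral_congr_ae (ae_restrict_of_ae ?_)
    filter_upwards [fourier_toLp_ae_eq hu1 hu2] with ξ hξ
    rw [hξ]
  have hsq : ‖U‖ ^ 2 ≤ (εΩ + √(pswfEigenvalue (a * b) N)) * ‖U‖ := by
    calc ‖U‖ ^ 2 = ‖inner ℂ (𝓕 U) (𝓕 F)‖ := by
          rw [norm_inner_symm, Lp.inner_fourier_eq, hUF, inner_self_eq_norm_sq_to_K]
          simp
      _ ≤ √(pswfEigenvalue (a * b) N * ‖U‖ ^ 2) * ‖F‖ + ‖U‖ * √(εΩ ^ 2) := by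
          refine (norm_inner_le_setIntegral (measurableSet_Icc (a := -(b / (2 * Real.pi)))
            (b := b / (2 * Real.pi))) _ _).trans ?_
          rw [Lp.norm_fourier_eq, Lp.norm_fourier_eq]
          gcongr
          exact hf.integral_fourier_le
      _ = _ := by
          rw [hFn, Real.sqrt_mul hlam, Real.sqrt_sq (norm_nonneg _), Real.sqrt_sq hΩ]; ring
  have hle : ‖U‖ ≤ εΩ + √(pswfEigenvalue (a * b) N) := by
    rcases (norm_nonneg U).eq_or_lt with h0 | h0
    · rw [← h0]; positivity
    · exact le_of_mul_le_mul_right (by linarith [pow_two ‖U‖]) h0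
  rw [← eLpNorm_indicator_eq_eLpNorm_restrict measurableSet_Icc, ← hu,
    ← ENNReal.ofReal_toReal hu2.eLpNorm_ne_top, ← Lp.norm_toLp u hu2]
  exact ENNReal.ofReal_le_ofReal hle

theorem IsConcentrated.eLpNorm_indicator_compl_le {a b εT εΩ : ℝ} {f : ℝ → ℂ} (hT : 0 ≤ εT)
    (hf : IsConcentrated a b εT εΩ f) :
    eLpNorm ((Icc (-a) a)ᶜ.indicator f) 2 volume ≤ ENNReal.ofReal εT := by
  rw [eLpNorm_indicator_eq_eLpNorm_restrict measurableSet_Icc.compl,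
    eLpNorm_two_eq (hf.memLp.restrict _)]
  exact ENNReal.ofReal_le_ofReal ((Real.sqrt_le_sqrt hf.time).trans_eq (Real.sqrt_sq hT))

theorem IsConcentrated.eLpNorm_sub_timeLimit_le {a b εT εΩ : ℝ} {f : ℝ → ℂ} (ha : 0 < a)
    (hb : 0 < b) (hT : 0 ≤ εT) (hΩ : 0 ≤ εΩ) (hf : IsConcentrated a b εT εΩ f) (N : ℕ) :
    eLpNorm (fun t => f t - timeLimit a (scaledPartialSum (a * b) a N f) t) 2 volume
      ≤ ENNReal.ofReal (εT + εΩ + √(pswfEigenvalue (a * b) N)) := by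
  have hsplit : (fun t => f t - timeLimit a (scaledPartialSum (a * b) a N f) t)
      = (Icc (-a) a)ᶜ.indicator f +
        (Icc (-a) a).indicator fun t => f t - scaledPartialSum (a * b) a N f t := by
    funext t
    by_cases ht : t ∈ Icc (-a) a <;> simp only [timeLimit, Pi.add_apply] <;> simp [ht]
  have hr := (hf.memLp.restrict (Icc (-a) a)).sub (memLp_scaledPartialSum ha hb N f)
  rw [hsplit, add_assoc, ENNReal.ofReal_add hT (by positivity)]
  refine (eLpNorm_add_le (hf.memLp.indicator measurableSet_Icc.compl).aestronglyMeasurable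
    ((memLp_indicator_iff_restrict measurableSet_Icc).2 hr).aestronglyMeasurable
    (by norm_num)).trans (add_le_add (hf.eLpNorm_indicator_compl_le hT) ?_)
  rw [eLpNorm_indicator_eq_eLpNorm_restrict measurableSet_Icc]
  exact hf.eLpNorm_sub_scaledPartialSum_le ha hb hΩ N

theorem scaledPartialSum_one (c : ℝ) (N : ℕ) (f : ℝ → ℂ) :
    scaledPartialSum c 1 N f = partialSum c N f := by
  funext t
  simp [scaledPartialSum, partialSum, scaledPswf]

end PSWF
theorem proposition3 :
    (∀ (c εT εΩ : ℝ) (f : ℝ → ℂ), 0 < c → 0 ≤ εT → 0 ≤ εΩ →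
      PSWF.IsConcentrated 1 c εT εΩ f → ∀ N : ℕ, 0 < N →
        MeasureTheory.eLpNorm (fun t => f t - PSWF.partialSum c N f t) 2
            (MeasureTheory.volume.restrict (Set.Icc (-1 : ℝ) 1))
          ≤ ENNReal.ofReal (εΩ + √(PSWF.pswfEigenvalue c N)) ∧
        MeasureTheory.eLpNorm (fun t => f t - PSWF.timeLimit 1 (PSWF.partialSum c N f) t) 2
            MeasureTheory.volume
          ≤ ENNReal.ofReal (εT + εΩ + √(PSWF.pswfEigenvalue c N))) ∧
    (∀ (a b c εT εΩ : ℝ) (f : ℝ → ℂ), 0 < a → 0 < b → c = a * b → 0 ≤ εT → 0 ≤ εΩ →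
      PSWF.IsConcentrated a b εT εΩ f → ∀ N : ℕ, 0 < N →
        MeasureTheory.eLpNorm (fun t => f t - PSWF.scaledPartialSum c a N f t) 2
            (MeasureTheory.volume.restrict (Set.Icc (-a) a))
          ≤ ENNReal.ofReal (εΩ + √(PSWF.pswfEigenvalue c N)) ∧
        MeasureTheory.eLpNorm (fun t => f t - PSWF.timeLimit a (PSWF.scaledPartialSum c a N f) t) 2
            MeasureTheory.volume
          ≤ ENNReal.ofReal (εT + εΩ + √(PSWF.pswfEigenvalue c N))) := by
  have hscaled : ∀ (a b εT εΩ : ℝ) (f : ℝ → ℂ), 0 < a → 0 < b → 0 ≤ εT → 0 ≤ εΩ →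
      PSWF.IsConcentrated a b εT εΩ f → ∀ N : ℕ,
        MeasureTheory.eLpNorm (fun t => f t - PSWF.scaledPartialSum (a * b) a N f t) 2
            (MeasureTheory.volume.restrict (Set.Icc (-a) a))
          ≤ ENNReal.ofReal (εΩ + √(PSWF.pswfEigenvalue (a * b) N)) ∧
        MeasureTheory.eLpNorm
            (fun t => f t - PSWF.timeLimit a (PSWF.scaledPartialSum (a * b) a N f) t) 2
            MeasureTheory.volume
          ≤ ENNReal.ofReal (εT + εΩ + √(PSWF.pswfEigenvalue (a * b) N)) :=
    fun a b εT εΩ f ha hb hT hΩ hf N =>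
      ⟨hf.eLpNorm_sub_scaledPartialSum_le ha hb hΩ N, hf.eLpNorm_sub_timeLimit_le ha hb hT hΩ N⟩
  refine ⟨fun c εT εΩ f hc hT hΩ hf N _ => ?_, fun a b c εT εΩ f ha hb hc hT hΩ hf N _ => ?_⟩
  · have h := hscaled 1 c εT εΩ f one_pos hc hT hΩ hf N
    rwa [one_mul, PSWF.scaledPartialSum_one] at h
  · subst hc
    exact hscaled a b εT εΩ f ha hb hT hΩ hf N
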